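/- Let $U\subseteq\mathbb{R}^N$ be open, $1\le p<\infty$, $0<s<1$, and let $\sigma:U\to(0,\infty]$ be a screening function, i.e. a lower semicontinuous function. Let $\tilde W^{s,p}_{(\sigma)}(U)$ be the space of all real-valued $f\in L^1_{\mathrm{loc}}(U)$ with $$|f|_{\tilde W^{s,p}_{(\sigma)}(U)}:=\left(\int_U\int_{B(x,\sigma(x))\cap U}\frac{|f(y)-f(x)|^p}{|y-x|^{sp+N}}\,dy\,dx\right)^{1/p}<\infty ,$$ where $B(x,\infty)=\mathbb{R}^N$; this is a seminorm. Say that two connected components of $U$ are linked if one contains a point $x$ and the other a point $y$ with $|y-x|<\sigma(x)$. Let $\mathcal{C}$ be the subspace of those $f\in\tilde W^{s,p}_{(\sigma)}(U)$ that are a.e. equal to a constant in each connected component of $U$, and let $\mathcal{C}_\sigma\subseteq\mathcal{C}$ be the subspace of those for which the constants on any two linked components agree. Then: (1) $\tilde W^{s,p}_{(\sigma)}(U)/\mathcal{C}_\sigma$ is a Banach space with the norm $\|[f]\|:=|f|_{\tilde W^{s,p}_{(\sigma)}(U)}$, and it is reflexive if $1<p<\infty$. (2) $\tilde W^{s,p}_{(\sigma)}(U)/\mathbb{R}:=\tilde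 W^{s,p}_{(\sigma)}(U)/\mathcal{C}$ is a Banach space with the quotient norm $\|[f]\|:=\inf_{k\in\mathcal{C}}|f-k|_{\tilde W^{s,p}_{(\sigma)}(U)}$, and it is reflexive if $1<p<\infty$. (3) If no two distinct components of $U$ are linked (in particular if $U$ is connected), then $\mathcal{C}_\sigma=\mathcal{C}$, and the norm in (2) is $\|[f]\|=|f|_{\tilde W^{s,p}_{(\sigma)}(U)}$. -/

import Mathlib

open MeasureTheory TopologicalSpace Topology
open scoped ENNReal

noncomputable section

/-- Lebesgue measure on an open set `U ⊆ ℝ^N`, as a measure on the type of points of `U`. -/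
abbrev lebesgueOn {N : ℕ} (U : Opens (EuclideanSpace ℝ (Fin N))) : Measure U :=
  (volume : Measure (EuclideanSpace ℝ (Fin N))).comap Subtype.val

/-- A screening function on `U`: a lower semicontinuous function `σ : U → (0, ∞]`. -/
structure ScreeningFunction {N : ℕ} (U : Opens (EuclideanSpace ℝ (Fin N))) where
  toFun : U → ℝ≥0∞
  pos : ∀ x, 0 < toFun x
  lsc : LowerSemicontinuous toFun

variable {N : ℕ} {U : Opens (EuclideanSpace ℝ (Fin N))}

/-- The double integral
`∫_U ∫_{B(x, σ(x)) ∩ U} |f(y) - f(x)|^p / |y - x|^(s p + N) dy dx ∈ [0, ∞]`. -/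
def screenedEnergy (σ : ScreeningFunction U) (s p : ℝ) (f : U → ℝ) : ℝ≥0∞ :=
  ∫⁻ x, ∫⁻ y in {y : U | edist y x < σ.toFun x},
    ‖f y - f x‖ₑ ^ p / edist y x ^ (s * p + N) ∂(lebesgueOn U) ∂(lebesgueOn U)

/-- The screened seminorm `|f|`, with values in `[0, ∞]`. -/
def screenedSeminorm (σ : ScreeningFunction U) (s p : ℝ) (f : U → ℝ) : ℝ≥0∞ :=
  screenedEnergy σ s p f ^ (1 / p)

instance isFiniteMeasureOnCompacts_lebesgueOn : IsFiniteMeasureOnCompacts (lebesgueOn U) :=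
  .comap' _ continuous_subtype_val (MeasurableEmbedding.subtype_coe U.isOpen.measurableSet)

instance sigmaFinite_lebesgueOn : SigmaFinite (lebesgueOn U) := by
  have : LocallyCompactSpace U := U.isOpen.locallyCompactSpace
  infer_instance

/-- The `p`-th root of the integrand, extended by zero to all pairs of points of `U`. -/
def screenedRoot (σ : ScreeningFunction U) (s p : ℝ) (f : U → ℝ) : U × U → ℝ≥0∞ :=
  {z : U × U | edist z.2 z.1 < σ.toFun z.1}.indicator
    fun z => ‖f z.2 - f z.1‖ₑ / edist z.2 z.1 ^ ((s * p + N) / p)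

theorem measurableSet_screened (σ : ScreeningFunction U) :
    MeasurableSet {z : U × U | edist z.2 z.1 < σ.toFun z.1} :=
  measurableSet_lt (measurable_snd.edist measurable_fst) (σ.lsc.measurable.comp measurable_fst)

theorem aemeasurable_screenedRoot (σ : ScreeningFunction U) (s p : ℝ) {f : U → ℝ}
    (hf : LocallyIntegrable f (lebesgueOn U)) :
    AEMeasurable (screenedRoot σ s p f) ((lebesgueOn U).prod (lebesgueOn U)) := by
  have h := hf.aestronglyMeasurable.aemeasurable
  refine AEMeasurable.indicator ?_ (measurableSet_screened σ)
  refine AEMeasurable.div (AEMeasurable.enorm (AEMeasurable.sub ?_ ?_)) ?_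
  · exact h.comp_snd
  · exact h.comp_fst
  · exact ((measurable_snd.edist measurable_fst).pow_const _).aemeasurable

theorem screenedEnergy_eq (σ : ScreeningFunction U) (s : ℝ) {p : ℝ} (hp : 0 < p) {f : U → ℝ}
    (hf : LocallyIntegrable f (lebesgueOn U)) :
    screenedEnergy σ s p f =
      ∫⁻ z, screenedRoot σ s p f z ^ p ∂((lebesgueOn U).prod (lebesgueOn U)) := by
  rw [lintegral_prod _ ((aemeasurable_screenedRoot σ s p hf).pow_const p)]
  refine lintegral_congr fun x => ?_
  have hm : MeasurableSet {y : U | edist y x < σ.toFun x} :=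
    measurableSet_lt (measurable_id.edist measurable_const) measurable_const
  rw [← lintegral_indicator hm]
  refine lintegral_congr fun y => ?_
  by_cases hy : edist y x < σ.toFun x
  · simp only [screenedRoot, Set.indicator, Set.mem_ofPred_eq, hy, if_true]
    rw [ENNReal.div_rpow_of_nonneg _ _ hp.le, ← ENNReal.rpow_mul, div_mul_cancel₀ _ hp.ne']
  · simp [screenedRoot, Set.indicator, hy, hp]

theorem screenedRoot_add_le (σ : ScreeningFunction U) (s p : ℝ) (f g : U → ℝ) (z : U × U) :
    screenedRoot σ s p (f + g) z ≤ (screenedRoot σ s p f + screenedRoot σ s p g) z := by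
  by_cases hz : edist z.2 z.1 < σ.toFun z.1
  · simp only [screenedRoot, Set.indicator, Set.mem_ofPred_eq, hz, if_true, Pi.add_apply]
    rw [← ENNReal.add_div]
    gcongr
    rw [add_sub_add_comm]
    exact enorm_add_le _ _
  · simp [screenedRoot, Set.indicator, hz]

theorem screenedSeminorm_add_le (σ : ScreeningFunction U) (s : ℝ) {p : ℝ} (hp : 1 ≤ p)
    {f g : U → ℝ} (hf : LocallyIntegrable f (lebesgueOn U))
    (hg : LocallyIntegrable g (lebesgueOn U)) :
    screenedSeminorm σ s p (f + g) ≤ screenedSeminorm σ s p f + screenedSeminorm σ s p g := by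
  have hp0 : 0 < p := by linarith
  simp only [screenedSeminorm]
  rw [screenedEnergy_eq σ s hp0 hf, screenedEnergy_eq σ s hp0 hg,
    screenedEnergy_eq σ s hp0 (hf.add hg)]
  refine le_trans ?_ (ENNReal.lintegral_Lp_add_le (aemeasurable_screenedRoot σ s p hf)
    (aemeasurable_screenedRoot σ s p hg) hp)
  gcongr with z
  exact screenedRoot_add_le σ s p f g z

theorem screenedSeminorm_smul (σ : ScreeningFunction U) (s : ℝ) {p : ℝ} (hp : 1 ≤ p)
    (c : ℝ) (f : U → ℝ) :
    screenedSeminorm σ s p (c • f) = ‖c‖ₑ * screenedSeminorm σ s p f := by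
  have hp0 : 0 < p := by linarith
  have hc : ‖c‖ₑ ^ p ≠ ∞ := ENNReal.rpow_ne_top_of_nonneg hp0.le enorm_ne_top
  have key : screenedEnergy σ s p (c • f) = ‖c‖ₑ ^ p * screenedEnergy σ s p f := by
    simp only [screenedEnergy]
    rw [← lintegral_const_mul' _ _ hc]
    refine lintegral_congr fun x => ?_
    rw [← lintegral_const_mul' _ _ hc]
    refine lintegral_congr fun y => ?_
    rw [Pi.smul_apply, Pi.smul_apply, ← smul_sub, smul_eq_mul, enorm_mul,
      ENNReal.mul_rpow_of_nonneg _ _ hp0.le, mul_div_assoc]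
  rw [screenedSeminorm, key, ENNReal.mul_rpow_of_nonneg _ _ (by positivity), ← ENNReal.rpow_mul,
    mul_one_div_cancel hp0.ne', ENNReal.rpow_one, screenedSeminorm]

/-- The functions `f ∈ L¹_loc(U)` with finite screened seminorm, as a vector space of functions. -/
def screenedSubmodule (σ : ScreeningFunction U) (s p : ℝ) [hp : Fact (1 ≤ p)] :
    Submodule ℝ (U → ℝ) where
  carrier := {f | LocallyIntegrable f (lebesgueOn U) ∧ screenedSeminorm σ s p f < ∞}
  zero_mem' := by
    refine ⟨locallyIntegrable_zero, ?_⟩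
    have h := screenedSeminorm_smul σ s hp.out 0 0
    rw [zero_smul, enorm_zero, zero_mul] at h
    rw [h]
    exact ENNReal.zero_lt_top
  add_mem' := fun hf hg => ⟨hf.1.add hg.1,
    (screenedSeminorm_add_le σ s hp.out hf.1 hg.1).trans_lt (ENNReal.add_lt_top.2 ⟨hf.2, hg.2⟩)⟩
  smul_mem' := fun c f hf => ⟨hf.1.smul c, by
    rw [screenedSeminorm_smul σ s hp.out]
    exact ENNReal.mul_lt_top enorm_lt_top hf.2⟩

/-- The screened homogeneous fractional Sobolev space. It is a type of its own, so that it carries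
the seminorm topology below and not the topology of pointwise convergence. -/
def ScreenedSpace (σ : ScreeningFunction U) (s p : ℝ) [Fact (1 ≤ p)] : Type :=
  ↥(screenedSubmodule σ s p)

namespace ScreenedSpace

variable {σ : ScreeningFunction U} {s p : ℝ} [hp : Fact (1 ≤ p)]

instance : AddCommGroup (ScreenedSpace σ s p) :=
  inferInstanceAs (AddCommGroup (screenedSubmodule σ s p))

instance : Module ℝ (ScreenedSpace σ s p) :=
  inferInstanceAs (Module ℝ (screenedSubmodule σ s p))

/-- The function underlying an element of the screened space. -/
def toFun (f : ScreenedSpace σ s p) : U → ℝ := f.1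

instance : Norm (ScreenedSpace σ s p) := ⟨fun f => (screenedSeminorm σ s p f.toFun).toReal⟩

theorem seminormedCore : SeminormedSpace.Core ℝ (ScreenedSpace σ s p) where
  norm_nonneg _ := ENNReal.toReal_nonneg
  norm_smul c f := by
    change (screenedSeminorm σ s p (c • f.toFun)).toReal = _
    rw [screenedSeminorm_smul σ s hp.out, ENNReal.toReal_mul, toReal_enorm]
    rfl
  norm_triangle f g := by
    change (screenedSeminorm σ s p (f.toFun + g.toFun)).toReal ≤ _
    refine (ENNReal.toReal_mono (ENNReal.add_lt_top.2 ⟨f.2.2, g.2.2⟩).ne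
      (screenedSeminorm_add_le σ s hp.out f.2.1 g.2.1)).trans ?_
    rw [ENNReal.toReal_add f.2.2.ne g.2.2.ne]
    rfl

/-- The screened space is seminormed by the screened seminorm. -/
instance : SeminormedAddCommGroup (ScreenedSpace σ s p) :=
  SeminormedAddCommGroup.ofCore seminormedCore

instance : NormedSpace ℝ (ScreenedSpace σ s p) where
  norm_smul_le c f := (seminormedCore.norm_smul c f).le

end ScreenedSpace

/-- The functions in the screened space that are almost everywhere equal to a constant in each
connected component of `U`. -/
def locallyConstants (σ : ScreeningFunction U) (s p : ℝ) [Fact (1 ≤ p)] :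
    Submodule ℝ (ScreenedSpace σ s p) where
  carrier := {f | ∀ x : U, ∃ c : ℝ, ∀ᵐ z ∂(lebesgueOn U),
    z ∈ connectedComponent x → f.toFun z = c}
  zero_mem' := fun _ => ⟨0, .of_forall fun _ _ => rfl⟩
  add_mem' := fun {f g} hf hg x => by
    obtain ⟨a, ha⟩ := hf x
    obtain ⟨b, hb⟩ := hg x
    refine ⟨a + b, ?_⟩
    filter_upwards [ha, hb] with z h1 h2 hz
    change f.toFun z + g.toFun z = a + b
    rw [h1 hz, h2 hz]
  smul_mem' := fun r f hf x => by
    obtain ⟨a, ha⟩ := hf x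
    refine ⟨r * a, ?_⟩
    filter_upwards [ha] with z h1 hz
    change r * f.toFun z = r * a
    rw [h1 hz]

/-- The functions in the screened space that are almost everywhere equal to a constant in each
connected component of `U`, with the same constant in any two components that are linked by `σ`,
that is, contain points `x` and `y` respectively with `|y - x| < σ(x)`. -/
def linkedConstants (σ : ScreeningFunction U) (s p : ℝ) [Fact (1 ≤ p)] :
    Submodule ℝ (ScreenedSpace σ s p) where
  carrier := {f | ∀ x y : U, edist y x < σ.toFun x → ∃ c : ℝ, ∀ᵐ z ∂(lebesgueOn U),
    z ∈ connectedComponent x ∪ connectedComponent y → f.toFun z = c}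
  zero_mem' := fun _ _ _ => ⟨0, .of_forall fun _ _ => rfl⟩
  add_mem' := fun {f g} hf hg x y hxy => by
    obtain ⟨a, ha⟩ := hf x y hxy
    obtain ⟨b, hb⟩ := hg x y hxy
    refine ⟨a + b, ?_⟩
    filter_upwards [ha, hb] with z h1 h2 hz
    change f.toFun z + g.toFun z = a + b
    rw [h1 hz, h2 hz]
  smul_mem' := fun r f hf x y hxy => by
    obtain ⟨a, ha⟩ := hf x y hxy
    refine ⟨r * a, ?_⟩
    filter_upwards [ha] with z h1 hz
    change r * f.toFun z = r * a
    rw [h1 hz]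

/-- A real vector space with a given seminorm is a Banach space if the seminorm is a norm and the
space is complete. -/
def IsBanachSpace (X : Type*) [SeminormedAddCommGroup X] [NormedSpace ℝ X] : Prop :=
  (∀ x : X, ‖x‖ = 0 → x = 0) ∧ CompleteSpace X

/-- The canonical map into the bidual is onto. -/
def IsReflexiveSpace (X : Type*) [SeminormedAddCommGroup X] [NormedSpace ℝ X] : Prop :=
  Function.Surjective (NormedSpace.inclusionInDoubleDual ℝ X)

end

/-!
Send `f` to its difference `f y - f x`, a function of the pair `(x, y)`. For the measure
`dx dy / |y - x| ^ (s p + N)` on the pairs with `|y - x| < σ(x)`, this is a linear isometry from the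
screened space into `L^p`. Its range is closed: where differences converge along a sequence, their
limit is again a difference, and it determines a locally integrable function. So the screened space
is complete. For `p > 1` it inherits the uniform convexity of `L^p`, which passes to quotients, and
the Milman–Pettis theorem gives reflexivity.

A function whose differences vanish almost everywhere on an open neighbourhood `V` of the diagonal
is almost everywhere equal to a locally constant function `g` with `g y = g x` on `V`. Taking for
`V` the pairs with `|y - x| < σ(x)`, or those of them within one component, both spaces of constants
become kernels of continuous maps.
-/

noncomputable section

section Reflexivity

theorem mem_closure_weakBilin_of_forall_le {M F : Type*} [AddCommGroup M] [Module ℝ M]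
    [AddCommGroup F] [Module ℝ F] (B : M →ₗ[ℝ] F →ₗ[ℝ] ℝ) {S : Set M} (hS : Convex ℝ S) {m : M}
    (hm : ∀ (f : F) (u : ℝ), (∀ a ∈ S, B a f < u) → B m f ≤ u) :
    m ∈ closure (X := WeakBilin B) S := by
  by_contra hmS
  obtain ⟨g, u, hg, hu⟩ := geometric_hahn_banach_closed_point
    (Convex.closure (E := WeakBilin B) hS) isClosed_closure hmS
  obtain ⟨f, rfl⟩ := LinearMap.dualEmbedding_surjective B g
  exact (hm f u fun a ha => hg a (subset_closure ha)).not_gt hu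

variable {E : Type*} [SeminormedAddCommGroup E] [NormedSpace ℝ E]

theorem exists_norm_le_one_lt_apply_of_lt_norm (f : StrongDual ℝ E) {a : ℝ} (h : a < ‖f‖) :
    ∃ x, ‖x‖ ≤ 1 ∧ a < f x := by
  by_contra! hf
  have ha : 0 ≤ a := by simpa using hf 0 (by simp)
  refine h.not_ge (f.opNorm_le_of_unit_norm ha fun x hx => abs_le'.2 ⟨hf x hx.le, ?_⟩)
  simpa using hf (-x) (by rw [norm_neg, hx])

theorem mul_norm_le_of_forall_apply_lt (f : StrongDual ℝ E) {r u : ℝ} (hr : 0 ≤ r)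
    (h : ∀ x, ‖x‖ ≤ r → f x < u) : r * ‖f‖ ≤ u := by
  have hu : 0 < u := by simpa using h 0 (by simpa using hr)
  rcases hr.eq_or_lt with rfl | hr
  · simpa using hu.le
  by_contra! hlt
  obtain ⟨x, hx, hux⟩ := exists_norm_le_one_lt_apply_of_lt_norm f ((div_lt_iff₀' hr).2 hlt)
  have hrx : f (r • x) < u := h _ (by
    rw [norm_smul, Real.norm_of_nonneg hr.le]
    exact mul_le_of_le_one_right hr.le hx)
  rw [map_smul, smul_eq_mul] at hrx
  exact hrx.not_gt ((div_lt_iff₀' hr).1 hux)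

/-- The canonical map into the bidual, the latter with its weak-* topology. -/
def toWeakBidual (x : E) : WeakDual ℝ (StrongDual ℝ E) :=
  StrongDual.toWeakDual (NormedSpace.inclusionInDoubleDual ℝ E x)

/-- **Goldstine's theorem**. -/
theorem toWeakDual_mem_closure_image_closedBall (Φ : StrongDual ℝ (StrongDual ℝ E)) :
    StrongDual.toWeakDual Φ ∈ closure (toWeakBidual '' Metric.closedBall (0 : E) ‖Φ‖) := by
  set K : Set (StrongDual ℝ (StrongDual ℝ E)) :=
    NormedSpace.inclusionInDoubleDual ℝ E '' Metric.closedBall 0 ‖Φ‖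
  have hK : Convex ℝ K := (convex_closedBall (0 : E) ‖Φ‖).linear_image
    (NormedSpace.inclusionInDoubleDual ℝ E).toLinearMap
  have hΦ : ∀ (f : StrongDual ℝ E) (u : ℝ), (∀ a ∈ K, a f < u) → Φ f ≤ u := fun f u hfu =>
    calc Φ f ≤ ‖Φ‖ * ‖f‖ := (le_abs_self _).trans (Φ.le_opNorm f)
      _ ≤ u := mul_norm_le_of_forall_apply_lt f (norm_nonneg Φ) fun x hx =>
        hfu _ ⟨x, by simpa using hx, rfl⟩
  have hclosure :=
    mem_closure_weakBilin_of_forall_le (topDualPairing ℝ (StrongDual ℝ E)) hK (m := Φ) hΦ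
  exact hclosure

theorem tendsto_apply_of_tendsto_toWeakBidual {F : Filter E} {Φ : StrongDual ℝ (StrongDual ℝ E)}
    (h : Filter.Tendsto toWeakBidual F (𝓝 (StrongDual.toWeakDual Φ))) (f : StrongDual ℝ E) :
    Filter.Tendsto (fun x => f x) F (𝓝 (Φ f)) :=
  ((WeakDual.eval_continuous f).tendsto (StrongDual.toWeakDual Φ)).comp h

theorem cauchy_of_tendsto_toWeakBidual [UniformConvexSpace E] {F : Filter E} [F.NeBot]
    {Φ : StrongDual ℝ (StrongDual ℝ E)}
    (hΦ : Filter.Tendsto toWeakBidual F (𝓝 (StrongDual.toWeakDual Φ)))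
    (hF : ∀ᶠ x in F, ‖x‖ ≤ ‖Φ‖) : Cauchy F := by
  refine Metric.cauchy_iff.2 ⟨inferInstance, fun ε hε => ?_⟩
  obtain ⟨δ, hδ, hE⟩ := exists_forall_closed_ball_dist_add_le_two_mul_sub E hε ‖Φ‖
  obtain ⟨f, hf, hfΦ⟩ := exists_norm_le_one_lt_apply_of_lt_norm Φ (sub_lt_self ‖Φ‖ (half_pos hδ))
  have hlt := (tendsto_apply_of_tendsto_toWeakBidual hΦ f).eventually_const_lt hfΦ
  refine ⟨_, hF.and hlt, fun x hx y hy => ?_⟩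
  rw [dist_eq_norm]
  by_contra! hxy
  have hadd : f (x + y) ≤ ‖x + y‖ :=
    (le_abs_self _).trans ((f.le_of_opNorm_le hf _).trans_eq (one_mul _))
  rw [map_add] at hadd
  linarith [hE hx.1 hy.1 hxy, hx.2, hy.2]

/-- The **Milman–Pettis theorem**. -/
theorem isReflexiveSpace_of_uniformConvexSpace [UniformConvexSpace E] [CompleteSpace E] :
    IsReflexiveSpace E := by
  intro Φ
  let F : Filter E :=
    Filter.comap toWeakBidual (𝓝 (StrongDual.toWeakDual Φ)) ⊓
      Filter.principal (Metric.closedBall 0 ‖Φ‖)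
  have : F.NeBot := by
    refine (Filter.map_neBot_iff toWeakBidual).1 ?_
    rw [Filter.push_pull', Filter.map_principal]
    exact mem_closure_iff_clusterPt.1 (toWeakDual_mem_closure_image_closedBall Φ)
  have hΦ : Filter.Tendsto toWeakBidual F (𝓝 (StrongDual.toWeakDual Φ)) :=
    Filter.tendsto_comap.mono_left inf_le_left
  have hF : ∀ᶠ x in F, ‖x‖ ≤ ‖Φ‖ := Filter.mem_inf_of_right (by simp [Set.subset_def])
  obtain ⟨x, hx⟩ := CompleteSpace.complete (cauchy_of_tendsto_toWeakBidual hΦ hF)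
  refine ⟨x, ContinuousLinearMap.ext fun f => ?_⟩
  exact tendsto_nhds_unique ((f.continuous.tendsto x).mono_left hx)
    (tendsto_apply_of_tendsto_toWeakBidual hΦ f)

theorem uniformConvexSpace_of_linearIsometry {G : Type*} [SeminormedAddCommGroup G]
    [NormedSpace ℝ G] [UniformConvexSpace G] (φ : E →ₗᵢ[ℝ] G) : UniformConvexSpace E where
  uniform_convex ε hε := by
    obtain ⟨δ, hδ, hG⟩ := exists_forall_sphere_dist_add_le_two_sub G hε
    refine ⟨δ, hδ, fun x hx y hy hxy => ?_⟩
    rw [← φ.norm_map] at hx hy hxy ⊢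
    rw [map_sub] at hxy
    rw [map_add]
    exact hG hx hy hxy

instance uniformConvexSpace_quotient [UniformConvexSpace E] (S : Submodule ℝ E) :
    UniformConvexSpace (E ⧸ S) where
  uniform_convex ε hε := by
    obtain ⟨δ, hδ, hE⟩ := exists_forall_closed_ball_dist_add_le_two_sub E (half_pos hε)
    refine ⟨δ, hδ, fun x hx y hy hxy => ?_⟩
    have hlim : Filter.Tendsto (fun t : ℝ => (1 + t) * (2 - δ)) (𝓝[>] 0) (𝓝 ((1 + 0) * (2 - δ))) :=
      (Continuous.tendsto (by fun_prop) 0).mono_left nhdsWithin_le_nhds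
    rw [add_zero, one_mul] at hlim
    refine ge_of_tendsto hlim ?_
    filter_upwards [Ioo_mem_nhdsGT one_pos] with t ⟨ht0, ht1⟩
    have ht : 0 < 1 + t := by linarith
    obtain ⟨a, rfl, ha⟩ := Submodule.Quotient.norm_mk_lt x ht0
    obtain ⟨b, rfl, hb⟩ := Submodule.Quotient.norm_mk_lt y ht0
    rw [hx] at ha
    rw [hy] at hb
    have hscale (c : E) : ‖(1 + t)⁻¹ • c‖ = (1 + t)⁻¹ * ‖c‖ := by
      rw [norm_smul, Real.norm_of_nonneg (by positivity)]
    have hab : ε ≤ ‖a - b‖ := hxy.trans (Submodule.Quotient.norm_mk_le (S := S) (a - b))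
    have h := hE (x := (1 + t)⁻¹ • a) (y := (1 + t)⁻¹ • b)
      (by rw [hscale, inv_mul_le_one₀ ht]; exact ha.le)
      (by rw [hscale, inv_mul_le_one₀ ht]; exact hb.le)
      (by rw [← smul_sub, hscale, le_inv_mul_iff₀ ht]; nlinarith)
    rw [← smul_add, hscale, inv_mul_le_iff₀ ht] at h
    exact (Submodule.Quotient.norm_mk_le (S := S) (a + b)).trans h

end Reflexivity

section UniformConvexity

variable {E : Type*}

section Seminormed

variable [SeminormedAddCommGroup E]

/-- The defect of midpoint convexity of `‖·‖ ^ p`. -/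
def midpointDefect (p : ℝ) (a b : E) : ℝ := (‖a‖ ^ p + ‖b‖ ^ p) / 2 - (‖a + b‖ / 2) ^ p

/-- A form of uniform convexity that is homogeneous of degree `p`, and is therefore inherited by
`L^p` spaces. -/
def IsPowerUniformlyConvex (p : ℝ) (E : Type*) [SeminormedAddCommGroup E] : Prop :=
  ∀ η > 0, ∃ C > 0, ∀ a b : E,
    ‖a - b‖ ^ p ≤ η * (‖a‖ ^ p + ‖b‖ ^ p) + C * midpointDefect p a b

theorem le_one_sub_div_of_rpow_le_one_sub {p t u : ℝ} (hp : 1 ≤ p) (ht : 0 ≤ t)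
    (h : t ^ p ≤ 1 - u) : t ≤ 1 - u / p := by
  have hp0 : 0 < p := by linarith
  have bernoulli := one_add_mul_self_le_rpow_one_add (show -1 ≤ t - 1 by linarith) hp
  rw [add_sub_cancel] at bernoulli
  rw [le_sub_comm, div_le_iff₀' hp0]
  linarith

theorem IsPowerUniformlyConvex.uniformConvexSpace {p : ℝ} (hp : 1 ≤ p)
    (h : IsPowerUniformlyConvex p E) : UniformConvexSpace E where
  uniform_convex ε hε := by
    have : 0 < ε ^ p := Real.rpow_pos_of_pos hε p
    obtain ⟨C, hC, hCE⟩ := h (ε ^ p / 4) (by positivity)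
    refine ⟨2 * (ε ^ p / (2 * C) / p), by positivity, fun x hx y hy hxy => ?_⟩
    have hdefect : midpointDefect p x y = 1 - (‖x + y‖ / 2) ^ p := by
      simp only [midpointDefect, hx, hy, Real.one_rpow]
      norm_num
    have hsub : ε ^ p ≤ ‖x - y‖ ^ p := by gcongr
    have hmid : (‖x + y‖ / 2) ^ p ≤ 1 - ε ^ p / (2 * C) := by
      have hxyC := hsub.trans (hCE x y)
      rw [hx, hy, Real.one_rpow, hdefect] at hxyC
      rw [le_sub_comm, div_le_iff₀ (by positivity)]
      linarith
    linarith [le_one_sub_div_of_rpow_le_one_sub hp (by positivity) hmid]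

end Seminormed

section StrictConvexity

variable [NormedAddCommGroup E] {p : ℝ}

theorem continuous_norm_rpow (hp : 0 ≤ p) : Continuous fun a : E => ‖a‖ ^ p :=
  continuous_norm.rpow_const fun _ => .inr hp

theorem continuous_midpointDefect (hp : 0 ≤ p) :
    Continuous fun z : E × E => midpointDefect p z.1 z.2 := by
  have h1 : Continuous fun z : E × E => ‖z.1‖ ^ p := (continuous_norm_rpow hp).comp continuous_fst
  have h2 : Continuous fun z : E × E => ‖z.2‖ ^ p := (continuous_norm_rpow hp).comp continuous_snd
  have h3 : Continuous fun z : E × E => (‖z.1 + z.2‖ / 2) ^ p :=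
    (by fun_prop : Continuous fun z : E × E => ‖z.1 + z.2‖ / 2).rpow_const fun _ => .inr hp
  exact ((h1.add h2).div_const 2).sub h3

theorem norm_rpow_add_norm_rpow_pos {z : E × E} (hz : z ≠ 0) : 0 < ‖z.1‖ ^ p + ‖z.2‖ ^ p := by
  have h : z.1 ≠ 0 ∨ z.2 ≠ 0 := by
    contrapose! hz
    exact Prod.ext hz.1 hz.2
  rcases h with h | h
  · exact add_pos_of_pos_of_nonneg (Real.rpow_pos_of_pos (norm_pos_iff.2 h) p) (by positivity)
  · exact add_pos_of_nonneg_of_pos (by positivity) (Real.rpow_pos_of_pos (norm_pos_iff.2 h) p)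

variable [NormedSpace ℝ E]

theorem norm_smul_rpow (c : ℝ) (a : E) : ‖c • a‖ ^ p = |c| ^ p * ‖a‖ ^ p := by
  rw [norm_smul, Real.norm_eq_abs, Real.mul_rpow (abs_nonneg c) (norm_nonneg a)]

theorem midpointDefect_smul (c : ℝ) (a b : E) :
    midpointDefect p (c • a) (c • b) = |c| ^ p * midpointDefect p a b := by
  simp only [midpointDefect, ← smul_add, Real.div_rpow (norm_nonneg _) zero_le_two, norm_smul_rpow]
  ring

theorem midpointDefect_pos [StrictConvexSpace ℝ E] (hp : 1 < p) {a b : E} (hab : a ≠ b) :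
    0 < midpointDefect p a b := by
  have : 0 < p := by linarith
  rw [midpointDefect, sub_pos]
  rcases eq_or_ne ‖a‖ ‖b‖ with h | h
  · have hlt : ‖a + b‖ / 2 < ‖b‖ := by
      have := (norm_midpoint_lt_iff h).2 hab
      rwa [norm_smul, h, Real.norm_of_nonneg (by norm_num), one_div_mul_eq_div] at this
    calc (‖a + b‖ / 2) ^ p < ‖b‖ ^ p := by gcongr
      _ = (‖a‖ ^ p + ‖b‖ ^ p) / 2 := by rw [h, add_self_div_two]
  · have hconvex := (strictConvexOn_rpow hp).2 (norm_nonneg a) (norm_nonneg b) h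
      (one_half_pos (α := ℝ)) one_half_pos (add_halves 1)
    simp only [smul_eq_mul] at hconvex
    calc (‖a + b‖ / 2) ^ p ≤ (1 / 2 * ‖a‖ + 1 / 2 * ‖b‖) ^ p := by
          gcongr
          linarith [norm_add_le a b]
      _ < 1 / 2 * ‖a‖ ^ p + 1 / 2 * ‖b‖ ^ p := hconvex
      _ = (‖a‖ ^ p + ‖b‖ ^ p) / 2 := by ring

theorem midpointDefect_nonneg [StrictConvexSpace ℝ E] (hp : 1 < p) (a b : E) :
    0 ≤ midpointDefect p a b := by
  rcases eq_or_ne a b with rfl | hab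
  · rw [midpointDefect, ← two_smul ℝ a, norm_smul, Real.norm_two,
      mul_div_cancel_left₀ _ two_ne_zero, add_self_div_two, sub_self]
  · exact (midpointDefect_pos hp hab).le

theorem exists_forall_sphere_norm_sub_rpow_le [StrictConvexSpace ℝ E] [ProperSpace E] (hp : 1 < p)
    {η : ℝ} (hη : 0 < η) :
    ∃ C > 0, ∀ z ∈ Metric.sphere (0 : E × E) 1,
      ‖z.1 - z.2‖ ^ p ≤ η * (‖z.1‖ ^ p + ‖z.2‖ ^ p) + C * midpointDefect p z.1 z.2 := by
  have hp0 : 0 < p := by linarith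
  have hdiff : Continuous fun z : E × E => ‖z.1 - z.2‖ ^ p :=
    (continuous_norm_rpow hp0.le).comp (continuous_fst.sub continuous_snd)
  have hsum : Continuous fun z : E × E => ‖z.1‖ ^ p + ‖z.2‖ ^ p :=
    ((continuous_norm_rpow hp0.le).comp continuous_fst).add
      ((continuous_norm_rpow hp0.le).comp continuous_snd)
  let K : Set (E × E) := Metric.sphere 0 1 ∩
    {z | η * (‖z.1‖ ^ p + ‖z.2‖ ^ p) ≤ ‖z.1 - z.2‖ ^ p}
  have hK : IsCompact K := (isCompact_sphere 0 1).inter_right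
    (isClosed_le (continuous_const.mul hsum) hdiff)
  have hdefect : ∀ z ∈ K, 0 < midpointDefect p z.1 z.2 := fun z hz => by
    refine midpointDefect_pos hp fun h => ?_
    have hlower : η * (‖z.1‖ ^ p + ‖z.2‖ ^ p) ≤ ‖z.1 - z.2‖ ^ p := hz.2
    rw [sub_eq_zero_of_eq h, norm_zero, Real.zero_rpow hp0.ne'] at hlower
    exact hlower.not_gt
      (mul_pos hη (norm_rpow_add_norm_rpow_pos (ne_zero_of_mem_unit_sphere ⟨z, hz.1⟩)))
  obtain ⟨m, hm, hmK⟩ :=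
    hK.exists_forall_le' (continuous_midpointDefect hp0.le).continuousOn hdefect
  obtain ⟨M, hM⟩ := hK.bddAbove_image hdiff.continuousOn
  refine ⟨max M 1 / m, by positivity, fun z hz => ?_⟩
  by_cases hzK : z ∈ K
  · calc ‖z.1 - z.2‖ ^ p ≤ max M 1 / m * m := by
          rw [div_mul_cancel₀ _ hm.ne']
          exact (hM ⟨z, hzK, rfl⟩).trans (le_max_left _ _)
      _ ≤ max M 1 / m * midpointDefect p z.1 z.2 := by gcongr; exact hmK z hzK
      _ ≤ _ := le_add_of_nonneg_left (by positivity)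
  · have hlt : ‖z.1 - z.2‖ ^ p < η * (‖z.1‖ ^ p + ‖z.2‖ ^ p) := by
      by_contra! h
      exact hzK ⟨hz, h⟩
    exact hlt.le.trans (le_add_of_nonneg_right
      (mul_nonneg (by positivity) (midpointDefect_nonneg hp _ _)))

theorem isPowerUniformlyConvex_of_properSpace [StrictConvexSpace ℝ E] [ProperSpace E]
    (hp : 1 < p) : IsPowerUniformlyConvex p E := by
  intro η hη
  obtain ⟨C, hC, hsphere⟩ := exists_forall_sphere_norm_sub_rpow_le (E := E) hp hη
  refine ⟨C, hC, fun a b => ?_⟩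
  rcases eq_or_ne (a, b) 0 with h | h
  · obtain ⟨rfl, rfl⟩ := Prod.mk.inj h
    simp [midpointDefect, Real.zero_rpow (by linarith : p ≠ 0)]
  have hr : 0 < ‖(a, b)‖⁻¹ := inv_pos.2 (norm_pos_iff.2 h)
  have hscaled := hsphere (‖(a, b)‖⁻¹ • (a, b)) (by
    rw [mem_sphere_zero_iff_norm, norm_smul, norm_inv, norm_norm,
      inv_mul_cancel₀ (norm_ne_zero_iff.2 h)])
  simp only [Prod.smul_fst, Prod.smul_snd, ← smul_sub, norm_smul_rpow, midpointDefect_smul]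
    at hscaled
  refine le_of_mul_le_mul_left ?_ (Real.rpow_pos_of_pos (abs_pos.2 hr.ne') p)
  linear_combination hscaled

end StrictConvexity

section Lp

variable [NormedAddCommGroup E] {α : Type*} [MeasurableSpace α] {ν : Measure α} {p : ℝ}

theorem integrable_norm_rpow_Lp (hp : 0 < p) (f : Lp E (ENNReal.ofReal p) ν) :
    Integrable (fun x => ‖f x‖ ^ p) ν := by
  simpa only [ENNReal.toReal_ofReal hp.le] using
    (Lp.memLp f).integrable_norm_rpow (by simpa using hp) ENNReal.ofReal_ne_top

theorem Lp_norm_rpow_eq_integral (hp : 0 < p) (f : Lp E (ENNReal.ofReal p) ν) :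
    ‖f‖ ^ p = ∫ x, ‖f x‖ ^ p ∂ν := by
  rw [Lp.norm_def, (Lp.memLp f).eLpNorm_eq_integral_rpow_norm (by simpa using hp)
      ENNReal.ofReal_ne_top, ENNReal.toReal_ofReal hp.le,
    ENNReal.toReal_ofReal (by positivity), Real.rpow_inv_rpow (by positivity) hp.ne']

theorem ae_norm_add_Lp_div_two_rpow (f g : Lp E (ENNReal.ofReal p) ν) :
    (fun x => ‖(f + g) x‖ ^ p / 2 ^ p) =ᵐ[ν] fun x => (‖f x + g x‖ / 2) ^ p := by
  filter_upwards [Lp.coeFn_add f g] with x hx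
  rw [hx, Pi.add_apply, Real.div_rpow (norm_nonneg _) zero_le_two]

theorem integrable_midpointDefect_Lp (hp : 0 < p) (f g : Lp E (ENNReal.ofReal p) ν) :
    Integrable (fun x => midpointDefect p (f x) (g x)) ν :=
  (((integrable_norm_rpow_Lp hp f).add (integrable_norm_rpow_Lp hp g)).div_const 2).sub
    (((integrable_norm_rpow_Lp hp (f + g)).div_const _).congr (ae_norm_add_Lp_div_two_rpow f g))

variable [Fact (1 ≤ ENNReal.ofReal p)]

theorem midpointDefect_Lp_eq_integral (hp : 0 < p) (f g : Lp E (ENNReal.ofReal p) ν) :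
    midpointDefect p f g = ∫ x, midpointDefect p (f x) (g x) ∂ν := by
  have hf := integrable_norm_rpow_Lp hp f
  have hg := integrable_norm_rpow_Lp hp g
  have hsum : Integrable (fun x => (‖f x‖ ^ p + ‖g x‖ ^ p) / 2) ν := (hf.add hg).div_const 2
  have hfg := (integrable_norm_rpow_Lp hp (f + g)).div_const (2 ^ p)
  have hadd := ae_norm_add_Lp_div_two_rpow f g
  simp only [midpointDefect]
  rw [integral_sub hsum (hfg.congr hadd), ← integral_congr_ae hadd,
    integral_div, integral_div, integral_add hf hg, Real.div_rpow (norm_nonneg _) zero_le_two]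
  simp only [Lp_norm_rpow_eq_integral hp]

theorem IsPowerUniformlyConvex.Lp (hp : 0 < p) (h : IsPowerUniformlyConvex p E) :
    IsPowerUniformlyConvex p (Lp E (ENNReal.ofReal p) ν) := by
  intro η hη
  obtain ⟨C, hC, hCE⟩ := h η hη
  refine ⟨C, hC, fun f g => ?_⟩
  have hsum : Integrable (fun x => η * (‖f x‖ ^ p + ‖g x‖ ^ p)) ν :=
    ((integrable_norm_rpow_Lp hp f).add (integrable_norm_rpow_Lp hp g)).const_mul η
  have hdefect := (integrable_midpointDefect_Lp hp f g).const_mul C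
  calc ‖f - g‖ ^ p = ∫ x, ‖(f - g) x‖ ^ p ∂ν := Lp_norm_rpow_eq_integral hp _
    _ ≤ ∫ x, η * (‖f x‖ ^ p + ‖g x‖ ^ p) + C * midpointDefect p (f x) (g x) ∂ν := by
        refine integral_mono_ae (integrable_norm_rpow_Lp hp _) (hsum.add hdefect) ?_
        filter_upwards [Lp.coeFn_sub f g] with x hx
        rw [hx]
        exact hCE (f x) (g x)
    _ = η * (‖f‖ ^ p + ‖g‖ ^ p) + C * midpointDefect p f g := by
        rw [integral_add hsum hdefect, integral_const_mul, integral_const_mul,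
          integral_add (integrable_norm_rpow_Lp hp f) (integrable_norm_rpow_Lp hp g),
          ← Lp_norm_rpow_eq_integral hp, ← Lp_norm_rpow_eq_integral hp,
          midpointDefect_Lp_eq_integral hp]

end Lp

theorem uniformConvexSpace_Lp [NormedAddCommGroup E] [NormedSpace ℝ E] [StrictConvexSpace ℝ E]
    [ProperSpace E] {α : Type*} [MeasurableSpace α] {ν : Measure α} {p : ℝ} (hp : 1 < p)
    [Fact (1 ≤ ENNReal.ofReal p)] : UniformConvexSpace (Lp E (ENNReal.ofReal p) ν) :=
  ((isPowerUniformlyConvex_of_properSpace hp).Lp (zero_lt_one.trans hp)).uniformConvexSpace hp.le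

end UniformConvexity

section PairDiff

variable {X : Type*} {E : Type*} [NormedAddCommGroup E] [NormedSpace ℝ E]

/-- The differences `f y - f x`, as a function of the pair `(x, y)`, depending linearly on `f`. -/
def pairDiff : (X → E) →ₗ[ℝ] (X × X → E) :=
  LinearMap.funLeft ℝ E Prod.snd - LinearMap.funLeft ℝ E Prod.fst

theorem pairDiff_apply (f : X → E) (z : X × X) : pairDiff f z = f z.2 - f z.1 := rfl

/-- The points `x` and `y` are equivalent if `u n y - u n x` converges. -/
def diffSetoid (u : ℕ → X → E) : Setoid X where
  r x y := ∃ l, Filter.Tendsto (fun n => u n y - u n x) Filter.atTop (𝓝 l)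
  iseqv :=
    { refl := fun x => ⟨0, by simp⟩
      symm := fun ⟨l, hl⟩ => ⟨-l, by simpa using hl.neg⟩
      trans := fun ⟨l, hl⟩ ⟨m, hm⟩ => ⟨m + l, by simpa using hm.add hl⟩ }

theorem exists_forall_tendsto_pairDiff (u : ℕ → X → E) :
    ∃ f : X → E, ∀ z, (∃ l, Filter.Tendsto (fun n => pairDiff (u n) z) Filter.atTop (𝓝 l)) →
      Filter.Tendsto (fun n => pairDiff (u n) z) Filter.atTop (𝓝 (pairDiff f z)) := by
  -- Subtracting from `u n` its value at a representative of the class makes it converge pointwise.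
  let r (x : X) : X := (Quotient.mk (diffSetoid u) x).out
  have hr (x : X) : ∃ l, Filter.Tendsto (fun n => u n x - u n (r x)) Filter.atTop (𝓝 l) :=
    Quotient.mk_out (s := diffSetoid u) x
  choose f hf using hr
  refine ⟨f, fun z hz => ?_⟩
  have hrz : r z.1 = r z.2 := congrArg Quotient.out (Quotient.sound (s := diffSetoid u) hz)
  simpa [pairDiff_apply, hrz] using (hf z.2).sub (hf z.1)

variable [MeasurableSpace X] {μ ν : Measure X}

theorem aestronglyMeasurable_pairDiff [SFinite μ] {f : X → E}
    (hf : AEStronglyMeasurable f μ) : AEStronglyMeasurable (pairDiff f) (μ.prod μ) :=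
  hf.comp_snd.sub hf.comp_fst

theorem integrable_of_integrable_pairDiff [NeZero μ] [SFinite μ] [IsFiniteMeasure ν] {f : X → E}
    (hf : Integrable (pairDiff f) (μ.prod ν)) : Integrable f ν := by
  obtain ⟨a, ha⟩ := hf.prod_right_ae.exists
  refine (ha.add (integrable_const (f a))).congr (.of_forall fun y => ?_)
  simp [pairDiff_apply]

end PairDiff

section LocallyConstant

variable {X Y : Type*} [TopologicalSpace X] [MeasurableSpace X] {μ : Measure X}
  [μ.IsOpenPosMeasure] {f : X → Y}

theorem neBot_ae_restrict_of_isOpen {A : Set X} (hA : IsOpen A) {x : X} (hx : x ∈ A) :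
    (ae (μ.restrict A)).NeBot :=
  ae_restrict_neBot.2 (hA.measure_ne_zero _ ⟨x, hx⟩)

variable [OpensMeasurableSpace X]

theorem exists_isLocallyConstant_ae_eq [SecondCountableTopology X]
    (h : ∀ x, ∃ B, IsOpen B ∧ x ∈ B ∧ ∃ c, ∀ᵐ y ∂μ.restrict B, f y = c) :
    ∃ g : X → Y, IsLocallyConstant g ∧ f =ᵐ[μ] g := by
  choose B hB hxB g hg using h
  have hgB (x y : X) (hy : y ∈ B x) : g y = g x := by
    have := neBot_ae_restrict_of_isOpen (μ := μ) ((hB x).inter (hB y)) ⟨hy, hxB y⟩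
    have hfx := ae_restrict_of_ae_restrict_of_subset (Set.inter_subset_left (t := B y)) (hg x)
    have hfy := ae_restrict_of_ae_restrict_of_subset (Set.inter_subset_right (s := B x)) (hg y)
    obtain ⟨z, hzx, hzy⟩ := (hfx.and hfy).exists
    exact hzy.symm.trans hzx
  refine ⟨g, (IsLocallyConstant.iff_exists_open g).2 fun x => ⟨B x, hB x, hxB x, hgB x⟩, ?_⟩
  refine measure_null_of_locally_null _ fun x _ =>
    ⟨_, inter_mem_nhdsWithin _ ((hB x).mem_nhds (hxB x)), ?_⟩
  refine measure_mono_null ?_ (ae_iff.1 ((ae_restrict_iff' (hB x).measurableSet).1 (hg x)))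
  rintro y ⟨hy, hyB⟩ hyx
  exact hy ((hyx hyB).trans (hgB x y hyB).symm)

theorem exists_isOpen_ae_restrict_eq_const [SFinite μ] {V : Set (X × X)} (hV : IsOpen V)
    (h : ∀ᵐ z ∂μ.prod μ, z ∈ V → f z.2 = f z.1) {x : X} (hx : (x, x) ∈ V) :
    ∃ B, IsOpen B ∧ x ∈ B ∧ ∃ c, ∀ᵐ y ∂μ.restrict B, f y = c := by
  obtain ⟨A, B, hA, hB, hxA, hxB, hAB⟩ := isOpen_prod_iff.1 hV x x hx
  have := neBot_ae_restrict_of_isOpen (μ := μ) hA hxA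
  obtain ⟨a, ha, haA⟩ := ((ae_restrict_of_ae (Measure.ae_ae_of_ae_prod h)).and
    (ae_restrict_mem hA.measurableSet)).exists
  refine ⟨B, hB, hxB, f a, (ae_restrict_iff' hB.measurableSet).2 ?_⟩
  exact ha.mono fun y hy hyB => hy (hAB ⟨haA, hyB⟩)

theorem ae_prod_eq_iff_exists_isLocallyConstant [SecondCountableTopology X] [SFinite μ]
    {V : Set (X × X)} (hV : IsOpen V) (hdiag : ∀ x, (x, x) ∈ V) :
    (∀ᵐ z ∂μ.prod μ, z ∈ V → f z.2 = f z.1) ↔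
      ∃ g : X → Y, IsLocallyConstant g ∧ f =ᵐ[μ] g ∧ ∀ x y, (x, y) ∈ V → g y = g x := by
  have on_pairs {g : X → Y} (hfg : f =ᵐ[μ] g) :
      ∀ᵐ z ∂μ.prod μ, f z.1 = g z.1 ∧ f z.2 = g z.2 :=
    (Measure.quasiMeasurePreserving_fst.ae hfg).and (Measure.quasiMeasurePreserving_snd.ae hfg)
  constructor
  · intro h
    obtain ⟨g, hg, hfg⟩ := exists_isLocallyConstant_ae_eq fun x =>
      exists_isOpen_ae_restrict_eq_const hV h (hdiag x)
    refine ⟨g, hg, hfg, fun x y hxy => ?_⟩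
    have hopen : IsOpen (V ∩ {z | g z.2 ≠ g z.1}) :=
      hV.inter (((hg.comp_continuous continuous_snd).prodMk
        (hg.comp_continuous continuous_fst)) {q | q.1 ≠ q.2})
    have hnull : (μ.prod μ) (V ∩ {z | g z.2 ≠ g z.1}) = 0 := by
      refine measure_mono_null ?_ (ae_iff.1 (h.and (on_pairs hfg)))
      rintro z ⟨hzV, hz⟩ ⟨hf, hz1, hz2⟩
      exact hz (by rw [← hz1, ← hz2, hf hzV])
    by_contra hne
    exact (hopen.eq_empty_of_measure_zero hnull).subset ⟨hxy, hne⟩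
  · rintro ⟨g, -, hfg, hgV⟩
    filter_upwards [on_pairs hfg] with z hz hzV
    rw [hz.1, hz.2, hgV z.1 z.2 hzV]

end LocallyConstant

section ScreenedMeasure

theorem restrict_le_inv_smul_withDensity {X : Type*} [MeasurableSpace X] {μ : Measure X}
    {ρ : X → ℝ≥0∞} {c : ℝ≥0∞} (hc : c ≠ 0) (hc' : c ≠ ∞) {Q : Set X} (hQ : MeasurableSet Q)
    (hcρ : ∀ z ∈ Q, c ≤ ρ z) : μ.restrict Q ≤ c⁻¹ • μ.withDensity ρ := by
  have hle : c • μ.restrict Q ≤ μ.withDensity ρ := by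
    rw [← withDensity_const]
    refine (withDensity_mono (ae_restrict_of_forall_mem hQ hcρ)).trans ?_
    rw [← restrict_withDensity hQ]
    exact Measure.restrict_le_self
  calc μ.restrict Q = c⁻¹ • c • μ.restrict Q := by
        rw [smul_smul, ENNReal.inv_mul_cancel hc hc', one_smul]
    _ ≤ c⁻¹ • μ.withDensity ρ := by gcongr

variable {N : ℕ} {U : Opens (EuclideanSpace ℝ (Fin N))}

instance isOpenPosMeasure_lebesgueOn : (lebesgueOn U).IsOpenPosMeasure :=
  Measure.IsOpenPosMeasure.comap volume U.isOpen.isOpenEmbedding_subtypeVal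

/-- The pairs `(x, y)` with `|y - x| < σ(x)`. -/
def screenedSet (σ : ScreeningFunction U) : Set (U × U) := {z | edist z.2 z.1 < σ.toFun z.1}

theorem isOpen_screenedSet (σ : ScreeningFunction U) : IsOpen (screenedSet σ) := by
  refine isOpen_iff_mem_nhds.2 fun z hz => ?_
  obtain ⟨t, hzt, htσ⟩ := exists_between (show edist z.2 z.1 < σ.toFun z.1 from hz)
  have hdist : ∀ᶠ w : U × U in 𝓝 z, edist w.2 w.1 < t :=
    (continuous_snd.edist continuous_fst).continuousAt.eventually_lt_const hzt
  have hlsc : ∀ᶠ w : U × U in 𝓝 z, t < σ.toFun w.1 :=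
    continuous_fst.continuousAt.eventually (σ.lsc z.1 t htσ)
  filter_upwards [hdist, hlsc] with w using lt_trans

theorem diag_mem_screenedSet (σ : ScreeningFunction U) (x : U) : (x, x) ∈ screenedSet σ := by
  simpa [screenedSet] using σ.pos x

/-- The density `|y - x| ^ (-(s p + N))` of the screened measure. -/
def screenedDensity (s p : ℝ) (z : U × U) : ℝ≥0∞ := (edist z.2 z.1 ^ (s * p + N))⁻¹

theorem continuous_screenedDensity (s p : ℝ) :
    Continuous (screenedDensity s p : U × U → ℝ≥0∞) :=
  (ENNReal.continuous_rpow_const.comp (continuous_snd.edist continuous_fst)).inv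

theorem screenedDensity_ne_zero (s p : ℝ) {z : U × U} (hz : z.2 ≠ z.1) :
    screenedDensity s p z ≠ 0 :=
  ENNReal.inv_ne_zero.2 (ENNReal.rpow_ne_top_of_ne_zero (by simpa using hz) (edist_ne_top _ _))

/-- The measure `dx dy / |y - x| ^ (s p + N)` on the pairs `(x, y)` with `|y - x| < σ(x)`, for which
the screened seminorm of `f` is the `L^p` norm of `f y - f x`. -/
def screenedMeasure (σ : ScreeningFunction U) (s p : ℝ) : Measure (U × U) :=
  (((lebesgueOn U).prod (lebesgueOn U)).restrict (screenedSet σ)).withDensity (screenedDensity s p)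

theorem screenedMeasure_absolutelyContinuous (σ : ScreeningFunction U) (s p : ℝ) :
    screenedMeasure σ s p ≪ (lebesgueOn U).prod (lebesgueOn U) :=
  (withDensity_absolutelyContinuous _ _).trans Measure.restrict_le_self.absolutelyContinuous

theorem ae_screenedMeasure_iff (σ : ScreeningFunction U) (s p : ℝ) {P : U × U → Prop}
    (hP : ∀ x, P (x, x)) :
    (∀ᵐ z ∂screenedMeasure σ s p, P z) ↔
      ∀ᵐ z ∂(lebesgueOn U).prod (lebesgueOn U), z ∈ screenedSet σ → P z := by
  rw [screenedMeasure, ae_withDensity_iff (continuous_screenedDensity s p).measurable,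
    ae_restrict_iff' (isOpen_screenedSet σ).measurableSet]
  refine Filter.eventually_congr (.of_forall fun z => imp_congr_right fun _ =>
    ⟨fun h => ?_, fun h _ => h⟩)
  by_cases hz : z.2 = z.1
  · obtain ⟨x, y⟩ := z
    obtain rfl : y = x := hz
    exact hP y
  · exact h (screenedDensity_ne_zero s p hz)

theorem ae_screenedMeasure_pairDiff_eq_zero_iff (σ : ScreeningFunction U) (s p : ℝ)
    {R : Set (U × U)} (hR : IsOpen R) (hdiag : ∀ x, (x, x) ∈ R) {f : U → ℝ} :
    (∀ᵐ z ∂screenedMeasure σ s p, z ∈ R → pairDiff f z = 0) ↔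
      ∃ g : U → ℝ, IsLocallyConstant g ∧ f =ᵐ[lebesgueOn U] g ∧
        ∀ x y, (x, y) ∈ screenedSet σ ∩ R → g y = g x := by
  rw [← ae_prod_eq_iff_exists_isLocallyConstant ((isOpen_screenedSet σ).inter hR)
    fun x => ⟨diag_mem_screenedSet σ x, hdiag x⟩,
    ae_screenedMeasure_iff σ s p fun x _ => sub_self (f x)]
  simp only [pairDiff_apply, sub_eq_zero, Set.mem_inter_iff, and_imp]

theorem screenedSeminorm_eq_eLpNorm (σ : ScreeningFunction U) (s : ℝ) {p : ℝ} (hp : 0 < p)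
    {f : U → ℝ} (hf : LocallyIntegrable f (lebesgueOn U)) :
    screenedSeminorm σ s p f =
      eLpNorm (pairDiff f) (ENNReal.ofReal p) (screenedMeasure σ s p) := by
  have hm : AEMeasurable (pairDiff f)
      (((lebesgueOn U).prod (lebesgueOn U)).restrict (screenedSet σ)) :=
    (aestronglyMeasurable_pairDiff hf.aestronglyMeasurable).aemeasurable.restrict
  rw [eLpNorm_eq_lintegral_rpow_enorm_toReal (by simpa using hp) (by simp),
    ENNReal.toReal_ofReal hp.le, screenedSeminorm, screenedEnergy_eq σ s hp hf, screenedMeasure,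
    lintegral_withDensity_eq_lintegral_mul₀
      (continuous_screenedDensity s p).measurable.aemeasurable (hm.enorm.pow_const p),
    ← lintegral_indicator (isOpen_screenedSet σ).measurableSet]
  congr 1
  refine lintegral_congr fun z => ?_
  by_cases hz : z ∈ screenedSet σ
  · rw [screenedRoot, ← screenedSet, Set.indicator_of_mem hz, Set.indicator_of_mem hz,
      ENNReal.div_rpow_of_nonneg _ _ hp.le, ← ENNReal.rpow_mul, div_mul_cancel₀ _ hp.ne',
      Pi.mul_apply, div_eq_mul_inv, mul_comm, screenedDensity, pairDiff_apply]
  · rw [screenedRoot, ← screenedSet, Set.indicator_of_notMem hz, Set.indicator_of_notMem hz,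
      ENNReal.zero_rpow_of_pos hp]

theorem exists_prod_restrict_le_smul_screenedMeasure (σ : ScreeningFunction U) (s p : ℝ)
    {x y : U} (hxy : (x, y) ∈ screenedSet σ) (hne : y ≠ x) :
    ∃ A B : Set U, IsOpen A ∧ IsOpen B ∧ x ∈ A ∧ y ∈ B ∧
      lebesgueOn U A < ∞ ∧ lebesgueOn U B < ∞ ∧ ∃ c ≠ ∞,
        ((lebesgueOn U).restrict A).prod ((lebesgueOn U).restrict B) ≤
          c • screenedMeasure σ s p := by
  have : LocallyCompactSpace U := U.isOpen.locallyCompactSpace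
  obtain ⟨c, hc, hcρ⟩ := exists_between
    (pos_iff_ne_zero.2 (screenedDensity_ne_zero s p (z := (x, y)) hne))
  have hO : IsOpen (screenedSet σ ∩ {z | c < screenedDensity s p z}) :=
    (isOpen_screenedSet σ).inter (isOpen_lt continuous_const (continuous_screenedDensity s p))
  obtain ⟨A, B, hA, hB, hxA, hyB, hAB⟩ := isOpen_prod_iff.1 hO x y ⟨hxy, hcρ⟩
  obtain ⟨A', hxA', hA', hA'top⟩ := (lebesgueOn U).exists_isOpen_measure_lt_top x
  obtain ⟨B', hyB', hB', hB'top⟩ := (lebesgueOn U).exists_isOpen_measure_lt_top y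
  have hsub : (A ∩ A') ×ˢ (B ∩ B') ⊆ screenedSet σ ∩ {z | c < screenedDensity s p z} :=
    (Set.prod_mono Set.inter_subset_left Set.inter_subset_left).trans hAB
  refine ⟨A ∩ A', B ∩ B', hA.inter hA', hB.inter hB', ⟨hxA, hxA'⟩, ⟨hyB, hyB'⟩,
    (measure_mono Set.inter_subset_right).trans_lt hA'top,
    (measure_mono Set.inter_subset_right).trans_lt hB'top, c⁻¹, ENNReal.inv_ne_top.2 hc.ne', ?_⟩
  have hle := restrict_le_inv_smul_withDensity
    (μ := ((lebesgueOn U).prod (lebesgueOn U)).restrict (screenedSet σ)) hc.ne' hcρ.ne_top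
    ((hA.inter hA').prod (hB.inter hB')).measurableSet fun z hz => (hsub hz).2.le
  rwa [Measure.restrict_restrict_of_subset fun z hz => (hsub hz).1,
    ← Measure.prod_restrict] at hle

theorem locallyIntegrable_of_memLp_pairDiff (σ : ScreeningFunction U) (s : ℝ) {p : ℝ} (hp : 1 ≤ p)
    {f : U → ℝ} (hf : MemLp (pairDiff f) (ENNReal.ofReal p) (screenedMeasure σ s p)) :
    LocallyIntegrable f (lebesgueOn U) := by
  intro y
  rcases (𝓝[≠] y).eq_or_neBot with hy | hy
  · exact ⟨{y}, (isOpen_singleton_iff_punctured_nhds y).2 hy |>.mem_nhds rfl,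
      integrableOn_singleton (hx := isCompact_singleton.measure_lt_top)⟩
  · have hscreened : ∀ᶠ x in 𝓝[≠] y, (x, y) ∈ screenedSet σ :=
      nhdsWithin_le_nhds ((Continuous.prodMk_left y).continuousAt.eventually_mem
        ((isOpen_screenedSet σ).mem_nhds (diag_mem_screenedSet σ y)))
    obtain ⟨x, hxy, hne⟩ := (hscreened.and eventually_mem_nhdsWithin).exists
    obtain ⟨A, B, hA, hB, hxA, hyB, hAtop, hBtop, c, hc, hle⟩ :=
      exists_prod_restrict_le_smul_screenedMeasure σ s p hxy (Ne.symm hne)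
    have : IsFiniteMeasure ((lebesgueOn U).restrict A) := ⟨by simpa using hAtop⟩
    have : IsFiniteMeasure ((lebesgueOn U).restrict B) := ⟨by simpa using hBtop⟩
    have : NeZero ((lebesgueOn U).restrict A) :=
      ⟨ae_neBot.1 (neBot_ae_restrict_of_isOpen hA hxA)⟩
    exact ⟨B, hB.mem_nhds hyB, integrable_of_integrable_pairDiff
      ((hf.of_measure_le_smul hc hle).integrable (ENNReal.one_le_ofReal.2 hp))⟩

end ScreenedMeasure

namespace ScreenedSpace

variable {N : ℕ} {U : Opens (EuclideanSpace ℝ (Fin N))} {σ : ScreeningFunction U} {s p : ℝ}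
  [hp : Fact (1 ≤ p)]

theorem locallyIntegrable (f : ScreenedSpace σ s p) :
    LocallyIntegrable f.toFun (lebesgueOn U) := f.2.1

theorem memLp_pairDiff (f : ScreenedSpace σ s p) :
    MemLp (pairDiff f.toFun) (ENNReal.ofReal p) (screenedMeasure σ s p) :=
  ⟨(aestronglyMeasurable_pairDiff f.locallyIntegrable.aestronglyMeasurable).mono_ac
    (screenedMeasure_absolutelyContinuous σ s p), by
    rw [← screenedSeminorm_eq_eLpNorm σ s (zero_lt_one.trans_le hp.out) f.locallyIntegrable]
    exact f.2.2⟩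

theorem exists_toFun_eq {f : U → ℝ}
    (hf : MemLp (pairDiff f) (ENNReal.ofReal p) (screenedMeasure σ s p)) :
    ∃ F : ScreenedSpace σ s p, F.toFun = f := by
  have hloc := locallyIntegrable_of_memLp_pairDiff σ s hp.out hf
  refine ⟨⟨f, hloc, ?_⟩, rfl⟩
  rw [screenedSeminorm_eq_eLpNorm σ s (zero_lt_one.trans_le hp.out) hloc]
  exact hf.2

instance fact_one_le_ofReal : Fact (1 ≤ ENNReal.ofReal p) := ⟨ENNReal.one_le_ofReal.2 hp.out⟩

variable (σ s p) in
/-- The linear isometry `f ↦ f y - f x` from the screened space to `L^p` of the screened measure. -/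
def pairDiffLp :
    ScreenedSpace σ s p →ₗᵢ[ℝ] Lp ℝ (ENNReal.ofReal p) (screenedMeasure σ s p) where
  toFun f := f.memLp_pairDiff.toLp
  map_add' f g := by
    rw [← MemLp.toLp_add f.memLp_pairDiff g.memLp_pairDiff]
    exact MemLp.toLp_congr _ _ (.of_eq (map_add pairDiff f.toFun g.toFun))
  map_smul' c f := by
    rw [RingHom.id_apply, ← MemLp.toLp_const_smul c f.memLp_pairDiff]
    exact MemLp.toLp_congr _ _ (.of_eq (map_smul pairDiff c f.toFun))
  norm_map' f := by
    change ‖f.memLp_pairDiff.toLp‖ = (screenedSeminorm σ s p f.toFun).toReal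
    rw [Lp.norm_toLp,
      screenedSeminorm_eq_eLpNorm σ s (zero_lt_one.trans_le hp.out) f.locallyIntegrable]

theorem coeFn_pairDiffLp (f : ScreenedSpace σ s p) :
    pairDiffLp σ s p f =ᵐ[screenedMeasure σ s p] pairDiff f.toFun :=
  f.memLp_pairDiff.coeFn_toLp

theorem isClosed_range_pairDiffLp : IsClosed (Set.range (pairDiffLp σ s p)) := by
  refine isClosed_of_closure_subset fun F hF => ?_
  obtain ⟨u, hu, hlim⟩ := mem_closure_iff_seq_limit.1 hF
  choose f hf using hu
  obtain ⟨n, -, hn⟩ := (tendstoInMeasure_of_tendsto_Lp hlim).exists_seq_tendsto_ae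
  obtain ⟨g, hg⟩ := exists_forall_tendsto_pairDiff fun k => (f (n k)).toFun
  have hFg : F =ᵐ[screenedMeasure σ s p] pairDiff g := by
    filter_upwards [hn, ae_all_iff.2 fun k => coeFn_pairDiffLp (f (n k))] with z hz hfz
    simp only [← hf, hfz] at hz
    exact tendsto_nhds_unique hz (hg z ⟨_, hz⟩)
  obtain ⟨G, rfl⟩ := exists_toFun_eq ((memLp_congr_ae hFg).1 (Lp.memLp F))
  exact ⟨G, Lp.ext ((coeFn_pairDiffLp G).trans hFg.symm)⟩

instance completeSpace : CompleteSpace (ScreenedSpace σ s p) :=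
  (pairDiffLp σ s p).isometry.isUniformInducing.completeSpace
    isClosed_range_pairDiffLp.isComplete

theorem uniformConvexSpace (hp1 : 1 < p) : UniformConvexSpace (ScreenedSpace σ s p) :=
  have := uniformConvexSpace_Lp (E := ℝ) (ν := screenedMeasure σ s p) hp1
  uniformConvexSpace_of_linearIsometry (pairDiffLp σ s p)

end ScreenedSpace

section Constants

theorem apply_eq_of_mem_connectedComponent {X Y : Type*} [TopologicalSpace X] {g : X → Y}
    (hg : IsLocallyConstant g) {x z : X} (hz : z ∈ connectedComponent x) : g z = g x :=
  hg.apply_eq_of_isPreconnected isPreconnected_connectedComponent hz mem_connectedComponent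

/-- The pairs of points that lie in the same connected component, as an open set when the space is
locally connected. -/
def componentPairs (X : Type*) [TopologicalSpace X] : Set (X × X) :=
  {z | z.2 ∈ connectedComponent z.1}

theorem isOpen_componentPairs {X : Type*} [TopologicalSpace X] [LocallyConnectedSpace X] :
    IsOpen (componentPairs X) := by
  refine isOpen_iff_mem_nhds.2 fun z hz => ?_
  have hnhds : connectedComponent z.1 ∈ 𝓝 z.2 := isOpen_connectedComponent.mem_nhds hz
  filter_upwards [prod_mem_nhds (isOpen_connectedComponent.mem_nhds mem_connectedComponent) hnhds]
    with w hw
  rw [componentPairs, Set.mem_ofPred_eq, ← connectedComponent_eq hw.1]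
  exact hw.2

variable {N : ℕ} {U : Opens (EuclideanSpace ℝ (Fin N))} {σ : ScreeningFunction U} {s p : ℝ}
  [hp : Fact (1 ≤ p)]

instance locallyConnectedSpace_opens : LocallyConnectedSpace U := U.isOpen.locallyConnectedSpace

theorem mem_locallyConstants_iff {f : ScreenedSpace σ s p} :
    f ∈ locallyConstants σ s p ↔
      ∃ g : U → ℝ, IsLocallyConstant g ∧ f.toFun =ᵐ[lebesgueOn U] g := by
  constructor
  · intro hf
    refine exists_isLocallyConstant_ae_eq fun x => ?_
    obtain ⟨c, hc⟩ := hf x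
    exact ⟨_, isOpen_connectedComponent, mem_connectedComponent, c,
      (ae_restrict_iff' isOpen_connectedComponent.measurableSet).2 hc⟩
  · rintro ⟨g, hg, hfg⟩ x
    refine ⟨g x, hfg.mono fun z hz hzx => ?_⟩
    rw [hz]
    exact apply_eq_of_mem_connectedComponent hg hzx

theorem linkedConstants_le_locallyConstants :
    linkedConstants σ s p ≤ locallyConstants σ s p := fun f hf x => by
  obtain ⟨c, hc⟩ := hf x x (diag_mem_screenedSet σ x)
  exact ⟨c, hc.mono fun z hz hzx => hz (.inl hzx)⟩

theorem mem_linkedConstants_iff {f : ScreenedSpace σ s p} :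
    f ∈ linkedConstants σ s p ↔
      ∃ g : U → ℝ, IsLocallyConstant g ∧ f.toFun =ᵐ[lebesgueOn U] g ∧
        ∀ x y, (x, y) ∈ screenedSet σ → g y = g x := by
  constructor
  · intro hf
    obtain ⟨g, hg, hfg⟩ := mem_locallyConstants_iff.1 (linkedConstants_le_locallyConstants hf)
    refine ⟨g, hg, hfg, fun x y hxy => ?_⟩
    obtain ⟨c, hc⟩ := hf x y hxy
    have eq_c (w : U) (hw : connectedComponent w ⊆ connectedComponent x ∪ connectedComponent y) :
        g w = c := by
      have := neBot_ae_restrict_of_isOpen (μ := lebesgueOn U) isOpen_connectedComponent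
        (mem_connectedComponent (x := w))
      obtain ⟨z, ⟨hzc, hzg⟩, hzw⟩ := ((ae_restrict_of_ae (hc.and hfg)).and
        (ae_restrict_mem (isOpen_connectedComponent (x := w)).measurableSet)).exists
      rw [← hzc (hw hzw), hzg, apply_eq_of_mem_connectedComponent hg hzw]
    rw [eq_c x Set.subset_union_left, eq_c y Set.subset_union_right]
  · rintro ⟨g, hg, hfg, hgσ⟩ x y hxy
    refine ⟨g x, hfg.mono fun z hz hzxy => ?_⟩
    rw [hz]
    rcases hzxy with hzx | hzy
    · exact apply_eq_of_mem_connectedComponent hg hzx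
    · rw [← hgσ x y hxy, apply_eq_of_mem_connectedComponent hg hzy]

theorem norm_eq_zero_iff_mem_linkedConstants {f : ScreenedSpace σ s p} :
    ‖f‖ = 0 ↔ f ∈ linkedConstants σ s p := by
  rw [← (ScreenedSpace.pairDiffLp σ s p).norm_map, norm_eq_zero, Lp.eq_zero_iff_ae_eq_zero,
    (ScreenedSpace.coeFn_pairDiffLp f).congr_left, mem_linkedConstants_iff]
  have hker := ae_screenedMeasure_pairDiff_eq_zero_iff σ s p isOpen_univ (fun _ => trivial)
    (f := f.toFun)
  simp only [Set.mem_univ, forall_const, Set.inter_univ] at hker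
  exact hker

theorem isClosed_linkedConstants :
    IsClosed (linkedConstants σ s p : Set (ScreenedSpace σ s p)) := by
  have : (linkedConstants σ s p : Set (ScreenedSpace σ s p)) = {f | ‖f‖ = 0} :=
    Set.ext fun _ => norm_eq_zero_iff_mem_linkedConstants.symm
  rw [this]
  exact isClosed_eq continuous_norm continuous_const

theorem mem_locallyConstants_iff_ae_pairDiff_eq_zero {f : ScreenedSpace σ s p} :
    f ∈ locallyConstants σ s p ↔
      ∀ᵐ z ∂screenedMeasure σ s p, z ∈ componentPairs U → pairDiff f.toFun z = 0 := by
  rw [mem_locallyConstants_iff,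
    ae_screenedMeasure_pairDiff_eq_zero_iff σ s p isOpen_componentPairs
      fun _ => mem_connectedComponent]
  refine exists_congr fun g => and_congr_right fun hg => ?_
  exact (and_iff_left fun x y hxy => apply_eq_of_mem_connectedComponent hg hxy.2).symm

theorem isClosed_locallyConstants :
    IsClosed (locallyConstants σ s p : Set (ScreenedSpace σ s p)) := by
  let T := (LpToLpRestrictCLM (U × U) ℝ ℝ (screenedMeasure σ s p) (ENNReal.ofReal p)
    (componentPairs U)).comp (ScreenedSpace.pairDiffLp σ s p).toContinuousLinearMap
  have hT (f : ScreenedSpace σ s p) : f ∈ locallyConstants σ s p ↔ T f = 0 := by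
    have hcoe : T f =ᵐ[(screenedMeasure σ s p).restrict (componentPairs U)] pairDiff f.toFun :=
      (LpToLpRestrictCLM_coeFn ℝ _ _).trans
        (ae_restrict_of_ae (ScreenedSpace.coeFn_pairDiffLp f))
    rw [mem_locallyConstants_iff_ae_pairDiff_eq_zero, Lp.eq_zero_iff_ae_eq_zero,
      hcoe.congr_left, Filter.EventuallyEq, ae_restrict_iff' isOpen_componentPairs.measurableSet]
    rfl
  rw [show (locallyConstants σ s p : Set (ScreenedSpace σ s p)) = {f | T f = 0} from Set.ext hT]
  exact isClosed_eq T.continuous continuous_const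

theorem linkedConstants_eq_locallyConstants
    (h : ∀ x y : U, edist y x < σ.toFun x → y ∈ connectedComponent x) :
    linkedConstants σ s p = locallyConstants σ s p := by
  refine le_antisymm linkedConstants_le_locallyConstants fun f hf => ?_
  obtain ⟨g, hg, hfg⟩ := mem_locallyConstants_iff.1 hf
  exact mem_linkedConstants_iff.2
    ⟨g, hg, hfg, fun x y hxy => apply_eq_of_mem_connectedComponent hg (h x y hxy)⟩

end Constants

section Quotients

variable {E : Type*} [SeminormedAddCommGroup E] [NormedSpace ℝ E]

theorem norm_mk_eq_norm_of_forall_norm_eq_zero {S : Submodule ℝ E} (hS : ∀ k ∈ S, ‖k‖ = 0)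
    (f : E) : ‖(Submodule.Quotient.mk f : E ⧸ S)‖ = ‖f‖ := by
  refine le_antisymm (Submodule.Quotient.norm_mk_le (S := S) f) ?_
  refine QuotientAddGroup.le_norm_iff.2 fun m hm => ?_
  have hk : ‖f - m‖ = 0 := hS _ ((Submodule.Quotient.eq S).1 hm.symm)
  simpa [hk] using norm_le_norm_add_norm_sub' f m

theorem norm_mk_eq_iInf (S : Submodule ℝ E) (f : E) :
    ‖(Submodule.Quotient.mk f : E ⧸ S)‖ = ⨅ k : S, ‖f - k‖ := by
  have h := QuotientAddGroup.norm_mk (S := S.toAddSubgroup) f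
  simp only [Metric.infDist_eq_iInf, dist_eq_norm] at h
  exact h

theorem isBanachSpace_quotient [CompleteSpace E] {S : Submodule ℝ E} (hS : IsClosed (S : Set E)) :
    IsBanachSpace (E ⧸ S) := by
  refine ⟨fun x hx => ?_, inferInstance⟩
  obtain ⟨f, rfl⟩ := Submodule.Quotient.mk_surjective S x
  exact (Submodule.Quotient.mk_eq_zero S).2 (hS.closure_subset
    ((QuotientAddGroup.norm_mk_eq_zero_iff_mem_closure (S := S.toAddSubgroup)).1 hx))

end Quotients

end

theorem theorem3p6_general {N : ℕ} (U : Opens (EuclideanSpace ℝ (Fin N)))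
    (σ : ScreeningFunction U) (s p : ℝ) [Fact (1 ≤ p)] :
    ((∀ f : ScreenedSpace σ s p,
        ‖(Submodule.Quotient.mk f : ScreenedSpace σ s p ⧸ linkedConstants σ s p)‖
          = (screenedSeminorm σ s p f.toFun).toReal) ∧
      IsBanachSpace (ScreenedSpace σ s p ⧸ linkedConstants σ s p) ∧
      (1 < p → IsReflexiveSpace (ScreenedSpace σ s p ⧸ linkedConstants σ s p))) ∧
    ((∀ f : ScreenedSpace σ s p,
        ‖(Submodule.Quotient.mk f : ScreenedSpace σ s p ⧸ locallyConstants σ s p)‖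
          = ⨅ k : locallyConstants σ s p,
              (screenedSeminorm σ s p (f.toFun - k.1.toFun)).toReal) ∧
      IsBanachSpace (ScreenedSpace σ s p ⧸ locallyConstants σ s p) ∧
      (1 < p → IsReflexiveSpace (ScreenedSpace σ s p ⧸ locallyConstants σ s p))) ∧
    ((∀ x y : U, edist y x < σ.toFun x → y ∈ connectedComponent x) →
      linkedConstants σ s p = locallyConstants σ s p ∧
      ∀ f : ScreenedSpace σ s p,
        ‖(Submodule.Quotient.mk f : ScreenedSpace σ s p ⧸ locallyConstants σ s p)‖
          = (screenedSeminorm σ s p f.toFun).toReal) := by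
  have hnorm (f : ScreenedSpace σ s p) :
      ‖(Submodule.Quotient.mk f : ScreenedSpace σ s p ⧸ linkedConstants σ s p)‖
        = (screenedSeminorm σ s p f.toFun).toReal :=
    norm_mk_eq_norm_of_forall_norm_eq_zero
      (fun _ hk => norm_eq_zero_iff_mem_linkedConstants.2 hk) f
  have hrefl (S : Submodule ℝ (ScreenedSpace σ s p)) (hp1 : 1 < p) :
      IsReflexiveSpace (ScreenedSpace σ s p ⧸ S) :=
    have := ScreenedSpace.uniformConvexSpace (σ := σ) (s := s) hp1
    isReflexiveSpace_of_uniformConvexSpace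
  refine ⟨⟨hnorm, isBanachSpace_quotient isClosed_linkedConstants, hrefl _⟩,
    ⟨norm_mk_eq_iInf _, isBanachSpace_quotient isClosed_locallyConstants, hrefl _⟩, fun h => ?_⟩
  have heq := linkedConstants_eq_locallyConstants (σ := σ) (s := s) (p := p) h
  exact ⟨heq, heq ▸ hnorm⟩

theorem theorem3p6 {N : ℕ} (U : Opens (EuclideanSpace ℝ (Fin N))) (σ : ScreeningFunction U)
    (s p : ℝ) [Fact (1 ≤ p)] (hs0 : 0 < s) (hs1 : s < 1) :
    -- modulo the functions constant in each component, equal on linked components: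
    -- the norm is the screened seminorm
    ((∀ f : ScreenedSpace σ s p,
        ‖(Submodule.Quotient.mk f : ScreenedSpace σ s p ⧸ linkedConstants σ s p)‖
          = (screenedSeminorm σ s p f.toFun).toReal) ∧
      IsBanachSpace (ScreenedSpace σ s p ⧸ linkedConstants σ s p) ∧
      (1 < p → IsReflexiveSpace (ScreenedSpace σ s p ⧸ linkedConstants σ s p))) ∧
    -- modulo all functions constant in each component, with the quotient norm
    ((∀ f : ScreenedSpace σ s p,
        ‖(Submodule.Quotient.mk f : ScreenedSpace σ s p ⧸ locallyConstants σ s p)‖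
          = ⨅ k : locallyConstants σ s p,
              (screenedSeminorm σ s p (f.toFun - k.1.toFun)).toReal) ∧
      IsBanachSpace (ScreenedSpace σ s p ⧸ locallyConstants σ s p) ∧
      (1 < p → IsReflexiveSpace (ScreenedSpace σ s p ⧸ locallyConstants σ s p))) ∧
    -- if no two distinct components are linked, the quotients and their norms coincide
    ((∀ x y : U, edist y x < σ.toFun x → y ∈ connectedComponent x) →
      linkedConstants σ s p = locallyConstants σ s p ∧
      ∀ f : ScreenedSpace σ s p,
        ‖(Submodule.Quotient.mk f : ScreenedSpace σ s p ⧸ locallyConstants σ s p)‖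
          = (screenedSeminorm σ s p f.toFun).toReal) :=
  theorem3p6_general U σ s p
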